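/- **Setting.** Let $\mathcal E$ be a Euclidean space and $p\ge 3$ an integer. A $C^{p,1}$ embedded submanifold is a nonempty set which near each of its points is the zero set of a $C^{p,1}$ map ($C^p$ with locally Lipschitz $p$-th derivative) into $\mathbb R^m$ whose differential at the point has rank $m$, with $m$ constant along the set ($m=0$ meaning an open set). Write $\mathrm T_x$, $\mathrm N_x$ for tangent and normal spaces, $\mathcal P_V$ for the orthogonal projection onto a subspace $V$, $\mathcal P_D(y)$ for the nearest point(s) of a set $D$ to $y$, $d_D$ for the distance to $D$, and $\mathcal N_\delta(K)=\{y:\ d_K(y)<\delta\}$. Let $\mathcal M_1,\mathcal M_2\subset\mathcal E$ be $C^{p,1}$ embedded submanifolds, $\mathcal M=\mathcal M_1\cap\mathcal M_2$, $\bar x\in\mathcal M$, let $\Omega\ni\bar x$ be relatively open in $\mathcal M$, and suppose that $K=\mathrm{cl}_{\mathcal M}\Omega$ is compact. Let $U\supset K$ be open in $\mathcal E$ and let $\phi_1:U\to\mathcal M_1$ and $\phi_2:U\to\mathcal E$ be $C^{p-1}$ maps, $\varphi=\phi_1\circ\phi_2$. **Assumptions.** 1. (Clean intersection.) Every $x\in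 K$ has an open neighbourhood $V$ in $\mathcal E$ such that $\mathcal M\cap V$ is a $C^{p,1}$ embedded submanifold and $\mathrm T_y\mathcal M=\mathrm T_y\mathcal M_1\cap \mathrm T_y\mathcal M_2$ for all $y\in\mathcal M\cap V$. 2. (Alternating framework.) Say that $\phi_i$ is first-order consistent if $\|\phi_i(y)-\mathcal P_{\mathcal M_i}(y)\|=o(d_{\mathcal M_i}(y))$ as $y\to x$, for every $x\in U\cap\mathcal M_i$. One of the following holds: (i) $\phi_1=\mathcal P_{\mathcal M_1}$ on $U$ and $\phi_2$ is first-order consistent; (ii) $\phi_2=\mathcal P_{\mathcal M_2}$ on $U$ and $\phi_1$ is first-order consistent; (iii) both $\phi_1,\phi_2$ are first-order consistent and $\phi_i(U)\subset\mathcal M_i$ for $i=1,2$. 3. (Residuals.) There is $\delta>0$ with $\mathcal N_\delta(K)\subset U$ such that, for $i=1,2$, $x\in K$ and $\|u\|<\delta$, $$\phi_i(x+u)=x+\mathcal P_{\mathrm T_x\mathcal M_i}(u)+R_{\mathrm N_i}(x,u)+R_{\mathrm T_i}(x,u),$$ where $R_{\mathrm N_i}(x,u)\in\mathrm N_x\mathcal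 M_i$ and $R_{\mathrm T_i}(x,u)\in\mathrm T_x\mathcal M_i$ are $C^{p-1}$ in $(x,u)\in K\times\mathbb B(0,\delta)$; along vectors $u\to0$ with $\mathcal P_{\mathrm N_x\mathcal M_i}(u)=o(\|u\|)$ one has $R_{\mathrm N_i}(x,u)=O(\|u\|^2)$ and $R_{\mathrm T_i}(x,u)=o(\|u\|^2)$, uniformly in $x\in K$; and $\varphi$ is $C^2$ on $\mathcal N_\delta(K)$ with Lipschitz second derivative there. **Conclusion.** There is $\rho>0$ such that for all $x\in K$ and $\eta\in\mathrm T_x\mathcal M$ with $\|\eta\|\le\rho$ the iterates $x_0=x+\eta$, $x_{k+1}=\varphi(x_k)$ are well defined ($x_k$ and $\phi_2(x_k)$ stay in $\mathcal N_\delta(K)$) and converge to a point $x^*=x^*(x,\eta)\in\mathcal M\cap\mathcal N_\delta(K)$, and, uniformly with respect to $x\in K$, $$\mathcal P_{\mathrm N_x\mathcal M}\bigl(x^*-(x+\eta)\bigr)=O(\|\eta\|^2),\qquad \mathcal P_{\mathrm T_x\mathcal M}\bigl(x^*-(x+\eta)\bigr)=o(\|\eta\|^2)\qquad(\eta\to0).$$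 -/

import Mathlib

open Set Filter Topology

noncomputable section

variable {E : Type*} [NormedAddCommGroup E] [InnerProductSpace ℝ E]

/-- `h` is of class `C^{p,1}` on the open set `U`: it is `p` times continuously differentiable
there and its `p`-th derivative is locally Lipschitz. -/
def IsCp1On {F : Type*} [NormedAddCommGroup F] [NormedSpace ℝ F]
    (p : ℕ) (h : E → F) (U : Set E) : Prop :=
  ContDiffOn ℝ p h U ∧ LocallyLipschitzOn U (iteratedFDeriv ℝ p h)

/-- `h` is a `C^{p,1}` local defining function for `M` at `x` on the open neighbourhood `U` of `x`:
`M ∩ U` is the zero set of `h` in `U`, and `D h (x)` has full rank `m`. -/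
structure IsLocalDefiningFunction (p m : ℕ) (M : Set E) (x : E) (U : Set E)
    (h : E → EuclideanSpace ℝ (Fin m)) : Prop where
  isOpen : IsOpen U
  mem : x ∈ U
  smooth : IsCp1On p h U
  zero_iff : ∀ y ∈ U, h y = 0 ↔ y ∈ M
  full_rank : Function.Surjective (fderiv ℝ h x)

/-- Nonempty `C^{p,1}` embedded submanifolds, of some constant codimension `m`.
For `m = 0` the condition says exactly that `M` is open. -/
def IsEmbeddedSubmanifold (p : ℕ) (M : Set E) : Prop :=
  M.Nonempty ∧ ∃ m : ℕ, ∀ x ∈ M, ∃ (U : Set E) (h : E → EuclideanSpace ℝ (Fin m)),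
    IsLocalDefiningFunction p m M x U h

/-- The tangent space `T_x M`: velocities at `x` of curves lying in `M`.  (For an embedded
submanifold these velocities already form a linear subspace; the span makes it one by type.) -/
def tangentSpaceAt (M : Set E) (x : E) : Submodule ℝ E :=
  Submodule.span ℝ {v : E | ∃ γ : ℝ → E, γ 0 = x ∧ (∀ᶠ t in 𝓝 (0 : ℝ), γ t ∈ M) ∧
    HasDerivAt γ v 0}

/-- The normal space `N_x M = (T_x M)ᗮ`. -/
def normalSpaceAt (M : Set E) (x : E) : Submodule ℝ E := (tangentSpaceAt M x)ᗮ

/-- Orthogonal projection of the ambient space onto `T_x M`. -/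
def tangentProj [FiniteDimensional ℝ E] (M : Set E) (x : E) : E →L[ℝ] E :=
  (tangentSpaceAt M x).starProjection

/-- Orthogonal projection of the ambient space onto `N_x M`. -/
def normalProj [FiniteDimensional ℝ E] (M : Set E) (x : E) : E →L[ℝ] E :=
  (normalSpaceAt M x).starProjection

/-- `M₁` and `M₂` intersect cleanly at `x`: near `x`, the intersection is a `C^{p,1}` embedded
submanifold, and there its tangent spaces are the intersections of those of `M₁` and `M₂`. -/
def IntersectCleanlyAt (p : ℕ) (M₁ M₂ : Set E) (x : E) : Prop :=
  x ∈ M₁ ∩ M₂ ∧ ∃ V : Set E, IsOpen V ∧ x ∈ V ∧ IsEmbeddedSubmanifold p (M₁ ∩ M₂ ∩ V) ∧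
    ∀ y ∈ M₁ ∩ M₂ ∩ V,
      tangentSpaceAt (M₁ ∩ M₂) y = tangentSpaceAt M₁ y ⊓ tangentSpaceAt M₂ y

/-- The set of nearest points of `D` to `y` (the metric projection of `y`). -/
def nearestPoints (D : Set E) (y : E) : Set E :=
  {z | z ∈ D ∧ ∀ w ∈ D, ‖z - y‖ ≤ ‖w - y‖}

/-- First-order consistency of `φ` with the metric projection onto `M`:
`‖φ(y) - P_M(y)‖ = o(d_M(y))` as `y → x`, for each `x ∈ U ∩ M`. -/
def FirstOrderConsistent (M U : Set E) (φ : E → E) : Prop :=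
  ∀ x ∈ U ∩ M, ∀ ε > (0 : ℝ), ∀ᶠ y in 𝓝 x, ∀ z ∈ nearestPoints M y,
    ‖φ y - z‖ ≤ ε * Metric.infDist y M

/-- The alternating framework on the open set `U`: `φ₁ : U → M₁` and `φ₂ : U → E` are `C^{p-1}` and
one of the three alternatives holds. Values of `φ₁`, `φ₂` outside `U` are irrelevant. -/
structure IsAlternatingFramework (p : ℕ) (M₁ M₂ U : Set E) (φ₁ φ₂ : E → E) : Prop where
  isOpen : IsOpen U
  mapsTo : MapsTo φ₁ U M₁
  smooth₁ : ContDiffOn ℝ (p - 1 : ℕ) φ₁ U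
  smooth₂ : ContDiffOn ℝ (p - 1 : ℕ) φ₂ U
  alternatives :
    ((∀ y ∈ U, φ₁ y ∈ nearestPoints M₁ y) ∧ FirstOrderConsistent M₂ U φ₂) ∨
    ((∀ y ∈ U, φ₂ y ∈ nearestPoints M₂ y) ∧ FirstOrderConsistent M₁ U φ₁) ∨
    (FirstOrderConsistent M₁ U φ₁ ∧ FirstOrderConsistent M₂ U φ₂ ∧
      MapsTo φ₁ U M₁ ∧ MapsTo φ₂ U M₂)

/-- The residual decomposition (case `p ≥ 3`) of one map `φ` with respect to one manifold `M`:
`φ(x+u) = x + P_{T_x M} u + R_N(x,u) + R_T(x,u)` for `x ∈ K`, `‖u‖ < δ`, with `C^{p-1}` residuals in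
the normal and tangent spaces. Along vectors `u → 0` with `P_{N_x M} u = o(‖u‖)` (quantified by a
modulus `ω`), the residuals are `O(‖u‖²)` and `o(‖u‖²)`, uniformly in `x ∈ K`. -/
def HasResidualDecomposition [FiniteDimensional ℝ E]
    (p : ℕ) (M K : Set E) (δ : ℝ) (φ : E → E) : Prop :=
  ∃ RN RT : E → E → E,
    (∀ x ∈ K, ∀ u ∈ Metric.ball (0 : E) δ,
      RN x u ∈ normalSpaceAt M x ∧ RT x u ∈ tangentSpaceAt M x ∧
      φ (x + u) = x + tangentProj M x u + RN x u + RT x u) ∧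
    ContDiffOn ℝ (p - 1 : ℕ) (fun q : E × E => RN q.1 q.2) (K ×ˢ Metric.ball (0 : E) δ) ∧
    ContDiffOn ℝ (p - 1 : ℕ) (fun q : E × E => RT q.1 q.2) (K ×ˢ Metric.ball (0 : E) δ) ∧
    ∀ ω : ℝ → ℝ, Tendsto ω (𝓝[>] 0) (𝓝 0) →
      (∃ C : ℝ, ∃ r > (0 : ℝ), ∀ x ∈ K, ∀ u ∈ Metric.ball (0 : E) δ, ‖u‖ < r →
        ‖normalProj M x u‖ ≤ ω ‖u‖ * ‖u‖ → ‖RN x u‖ ≤ C * ‖u‖ ^ 2) ∧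
      (∀ ε > (0 : ℝ), ∃ r > (0 : ℝ), ∀ x ∈ K, ∀ u ∈ Metric.ball (0 : E) δ, ‖u‖ < r →
        ‖normalProj M x u‖ ≤ ω ‖u‖ * ‖u‖ → ‖RT x u‖ ≤ ε * ‖u‖ ^ 2)

/-- The residual assumption for `p ≥ 3`: both maps have residual decompositions, and
`φ = φ₁ ∘ φ₂` is `C²` with Lipschitz second derivative on the open `δ`-neighbourhood of `K`. -/
structure ResidualAssumption [FiniteDimensional ℝ E]
    (p : ℕ) (M₁ M₂ K : Set E) (δ : ℝ) (φ₁ φ₂ : E → E) : Prop where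
  residual₁ : HasResidualDecomposition p M₁ K δ φ₁
  residual₂ : HasResidualDecomposition p M₂ K δ φ₂
  smooth : ContDiffOn ℝ 2 (φ₁ ∘ φ₂) (Metric.thickening δ K)
  lipschitz : ∃ Λ > (0 : ℝ), ∀ y ∈ Metric.thickening δ K, ∀ z ∈ Metric.thickening δ K,
    ‖iteratedFDeriv ℝ 2 (φ₁ ∘ φ₂) y - iteratedFDeriv ℝ 2 (φ₁ ∘ φ₂) z‖ ≤ Λ * ‖y - z‖

end

/-!
The composition `φ = φ₁ ∘ φ₂` contracts the distance to `M = M₁ ∩ M₂` near `K`, so that the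
iterates converge geometrically to a point of `M`; the rate is then combined with the second-order
accuracy of a single step.

*Contraction.* At a point `x` of `M`, first-order consistency with the nearest point map forces
`D φᵢ x` to be the orthogonal projection onto `T_x Mᵢ`
(`ApproximatesNearestPointsAt.fderiv_eq`). Hence `D φ x` is a product of two projections, which
contracts the orthogonal complement of `T_x M₁ ⊓ T_x M₂ = T_x M` strictly
(`exists_norm_starProjection_comp_le`). If `y` is a nearest point of `M` to `z`, then `z - y` is
normal to `M` at `y`, and normal spaces near `x` are almost orthogonal to `T_x M`
(`eventually_norm_starProjection_normal_le`), so strict differentiability at `x` gives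
`‖φ z - y‖ ≤ c ‖z - y‖` with `c < 1` for `z` near `x`. Compactness makes `c` and the size of the
neighbourhood uniform on `K`. It follows that the iterates of a point `z` near `K` converge to a
point of `M`, with `k`-th error `O(c ^ k d_M(z))`
(`exists_tendsto_iterate_of_contractsToNearest`).

*Errors.* Let `z = x + η` with `η ∈ T_x M`. The contraction bounds `d_M(z)` by a multiple of
`‖φ z - z‖`, and the residual decompositions bound the latter by `O(‖η‖²)`. So the whole orbit and
its limit stay within `O(‖η‖²)` of `x + η`, which is the normal estimate. At all such points the
residual decompositions apply and show that one step moves the `T_x M` component only by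
`o(‖η‖²)` (`HasResidualDecomposition.tangentiallySecondOrder`). Finitely many steps therefore
contribute `o(‖η‖²)`, while the remaining ones contribute `O(c ^ k ‖η‖²)` with `k` arbitrarily
large, which is the tangential estimate.
-/

section

variable {E : Type*} [NormedAddCommGroup E] [InnerProductSpace ℝ E]

/-! ### Tangent and normal spaces of a zero set -/

namespace IsLocalDefiningFunction

variable {p m : ℕ} {M U : Set E} {x : E} {h : E → EuclideanSpace ℝ (Fin m)}

theorem of_inter_open {V : Set E} (H : IsLocalDefiningFunction p m (M ∩ V) x U h)
    (hV : IsOpen V) (hx : x ∈ V) : IsLocalDefiningFunction p m M x (U ∩ V) h where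
  isOpen := H.isOpen.inter hV
  mem := ⟨H.mem, hx⟩
  smooth := ⟨H.smooth.1.mono inter_subset_left, H.smooth.2.mono inter_subset_left⟩
  zero_iff y hy := by simpa [hy.2] using H.zero_iff y hy.1
  full_rank := H.full_rank

theorem contDiffAt (H : IsLocalDefiningFunction p m M x U h) : ContDiffAt ℝ p h x :=
  H.smooth.1.contDiffAt (H.isOpen.mem_nhds H.mem)

/-- At any other point of the domain of a defining function, only the rank is at stake. -/
theorem of_surjective (H : IsLocalDefiningFunction p m M x U h) {y : E} (hy : y ∈ U)
    (hs : Function.Surjective (fderiv ℝ h y)) : IsLocalDefiningFunction p m M y U h :=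
  ⟨H.isOpen, hy, H.smooth, H.zero_iff, hs⟩

theorem tangentSpaceAt_le_ker (H : IsLocalDefiningFunction p m M x U h) (hp : p ≠ 0) :
    tangentSpaceAt M x ≤ (fderiv ℝ h x).ker := by
  refine Submodule.span_le.2 ?_
  rintro v ⟨γ, rfl, hγM, hγ⟩
  have hd : HasFDerivAt h (fderiv ℝ h (γ 0)) (γ 0) :=
    (H.contDiffAt.differentiableAt (by exact_mod_cast hp)).hasFDerivAt
  have h1 := hd.comp_hasDerivAt (0 : ℝ) hγ
  have h2 : h ∘ γ =ᶠ[𝓝 0] fun _ => 0 := by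
    filter_upwards [hγM, hγ.continuousAt.eventually (H.isOpen.mem_nhds H.mem)] with t ht htU
    exact (H.zero_iff _ htU).2 ht
  exact h1.unique ((hasDerivAt_const (0 : ℝ) _).congr_of_eventuallyEq h2)

/-- Vectors of the kernel are velocities of curves in `M`, by the implicit function theorem. -/
theorem ker_le_tangentSpaceAt [CompleteSpace E] (H : IsLocalDefiningFunction p m M x U h)
    (hp : p ≠ 0) (hx : x ∈ M) : (fderiv ℝ h x).ker ≤ tangentSpaceAt M x := by
  intro v hv
  have hs : HasStrictFDerivAt h (fderiv ℝ h x) x :=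
    H.contDiffAt.hasStrictFDerivAt (by exact_mod_cast hp)
  have hr : (fderiv ℝ h x).range = ⊤ := LinearMap.range_eq_top.2 H.full_rank
  have h0 : h x = 0 := (H.zero_iff x H.mem).2 hx
  let w : (fderiv ℝ h x).ker := ⟨v, hv⟩
  let g := hs.implicitFunction h (fderiv ℝ h x) hr (h x)
  have hg0 : g 0 = x := by
    exact hs.implicitFunction_apply_image hr
  have hgd : HasStrictFDerivAt g (fderiv ℝ h x).ker.subtypeL 0 := hs.to_implicitFunction hr
  have hlin : HasDerivAt (fun t : ℝ => t • w) w 0 := by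
    simpa using (hasDerivAt_id (0 : ℝ)).smul_const w
  have hcurve : HasDerivAt (fun t : ℝ => g (t • w)) v 0 := by
    have h1 : HasFDerivAt g (fderiv ℝ h x).ker.subtypeL ((0 : ℝ) • w) := by
      simpa using hgd.hasFDerivAt
    exact h1.comp_hasDerivAt (0 : ℝ) hlin
  refine Submodule.subset_span ⟨fun t => g (t • w), by simpa using hg0, ?_, hcurve⟩
  have hU : ∀ᶠ t : ℝ in 𝓝 0, g (t • w) ∈ U :=
    hcurve.continuousAt.eventually (H.isOpen.mem_nhds (by simpa [hg0] using H.mem))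
  have hz : ∀ᶠ t : ℝ in 𝓝 0, h (g (t • w)) = h x := by
    have h1 := hs.map_implicitFunction_eq hr
    have h2 : Tendsto (fun t : ℝ => (h x, t • w)) (𝓝 0) (𝓝 (h x, 0)) := by
      have : ContinuousAt (fun t : ℝ => (h x, t • w)) 0 :=
        continuousAt_const.prodMk hlin.continuousAt
      simpa [ContinuousAt] using this
    exact h2.eventually h1
  filter_upwards [hU, hz] with t ht hzt
  exact (H.zero_iff _ ht).1 (hzt.trans h0)

end IsLocalDefiningFunction

/-- The normal spaces of `M` at points near `x` are almost orthogonal to the tangent space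
at `x`.  A tangent vector `v` at `x` is moved to the kernel of `D h y` by subtracting
`B (D h y ∘ B)⁻¹ (D h y) v`, where `B` is a right inverse of `D h x`; this correction tends to
zero as `y → x`. -/
theorem eventually_norm_starProjection_normal_le [FiniteDimensional ℝ E] {p m : ℕ} {M U : Set E}
    {x : E} {h : E → EuclideanSpace ℝ (Fin m)} (H : IsLocalDefiningFunction p m M x U h)
    (hp : p ≠ 0) {ε : ℝ} (hε : 0 < ε) :
    ∀ᶠ y in 𝓝 x, y ∈ M → ∀ n ∈ normalSpaceAt M y,
      ‖(tangentSpaceAt M x).starProjection n‖ ≤ ε * ‖n‖ := by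
  have : CompleteSpace E := FiniteDimensional.complete ℝ E
  obtain ⟨B, hB⟩ := (fderiv ℝ h x).exists_rightInverse_of_surjective
    (LinearMap.range_eq_top.2 H.full_rank)
  have hA : ContinuousAt (fderiv ℝ h) x :=
    (H.contDiffAt.of_le (m := 1) (by exact_mod_cast Nat.one_le_iff_ne_zero.2 hp)).continuousAt_fderiv
      one_ne_zero
  let G : E → (EuclideanSpace ℝ (Fin m) →L[ℝ] EuclideanSpace ℝ (Fin m)) :=
    fun y => (fderiv ℝ h y).comp B
  have hG : ContinuousAt G x := hA.clm_comp continuousAt_const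
  have hGx : G x = 1 := hB
  have hunit : ∀ᶠ y in 𝓝 x, IsUnit (G y) :=
    hG.eventually (by rw [hGx]; exact Units.nhds 1)
  have hinv : ContinuousAt (fun y => Ring.inverse (G y)) x := by
    have h1 : ContinuousAt Ring.inverse (G x) := by
      rw [hGx]; exact NormedRing.inverse_continuousAt 1
    exact h1.comp hG
  let Q : E → (E →L[ℝ] E) := fun y => (B.comp (Ring.inverse (G y))).comp (fderiv ℝ h y)
  have hQ : ContinuousAt Q x := (continuousAt_const.clm_comp hinv).clm_comp hA
  have hQε : ∀ᶠ y in 𝓝 x, ‖Q y - Q x‖ < ε := by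
    have := Metric.tendsto_nhds.1 hQ ε hε
    simpa [dist_eq_norm] using this
  filter_upwards [hunit, hQε, H.isOpen.mem_nhds H.mem] with y hu hQy hyU hyM n hn
  set v := (tangentSpaceAt M x).starProjection n with hv
  have hvT : v ∈ tangentSpaceAt M x := Submodule.starProjection_apply_mem _ _
  have hQx : Q x v = 0 := by
    have : fderiv ℝ h x v = 0 := H.tangentSpaceAt_le_ker hp hvT
    simp [Q, this]
  have hGinv : ∀ w, fderiv ℝ h y (B (Ring.inverse (G y) w)) = w := fun w => by
    have := congrArg (fun T => T w) (Ring.mul_inverse_cancel _ hu)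
    simpa [G] using this
  have hs : Function.Surjective (fderiv ℝ h y) := fun w => ⟨_, hGinv w⟩
  have hker : v - Q y v ∈ tangentSpaceAt M y := by
    refine (H.of_surjective hyU hs).ker_le_tangentSpaceAt hp hyM ?_
    simp [Q, hGinv]
  have hQv : ‖Q y v‖ ≤ ε * ‖v‖ := by
    have h1 : Q y v = (Q y - Q x) v := by simp [hQx]
    rw [h1]
    exact ((Q y - Q x).le_opNorm v).trans (by gcongr)
  have h1 : inner ℝ n v = inner ℝ n (Q y v) := by
    have := Submodule.inner_left_of_mem_orthogonal hker hn
    rw [inner_sub_right] at this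
    linarith
  have h2 : inner ℝ n v = ‖v‖ ^ 2 := by
    have := (tangentSpaceAt M x).starProjection_inner_eq_zero n v hvT
    rw [inner_sub_left, ← hv, real_inner_self_eq_norm_sq] at this
    linarith
  have h3 : ‖v‖ * ‖v‖ ≤ (ε * ‖n‖) * ‖v‖ := by
    have := real_inner_le_norm n (Q y v)
    have h4 : ‖n‖ * ‖Q y v‖ ≤ ‖n‖ * (ε * ‖v‖) := by gcongr
    nlinarith
  rcases (norm_nonneg v).eq_or_lt with h0 | h0
  · rw [← h0]; positivity
  · exact le_of_mul_le_mul_right h3 h0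

/-! ### Nearest points -/

theorem IsLocalDefiningFunction.eventually_exists_nearestPoints [FiniteDimensional ℝ E]
    {p m : ℕ} {M U : Set E} {x : E} {h : E → EuclideanSpace ℝ (Fin m)}
    (H : IsLocalDefiningFunction p m M x U h) (hx : x ∈ M) :
    ∀ᶠ z in 𝓝 x, (nearestPoints M z).Nonempty := by
  have : ProperSpace E := FiniteDimensional.proper ℝ E
  obtain ⟨R, hR, hRU⟩ := Metric.nhds_basis_closedBall.mem_iff.1 (H.isOpen.mem_nhds H.mem)
  have hset : M ∩ Metric.closedBall x R = Metric.closedBall x R ∩ h ⁻¹' {0} := by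
    ext y
    constructor
    · exact fun hy => ⟨hy.2, (H.zero_iff y (hRU hy.2)).2 hy.1⟩
    · exact fun hy => ⟨(H.zero_iff y (hRU hy.1)).1 hy.2, hy.1⟩
  have hc : IsCompact (M ∩ Metric.closedBall x R) := by
    refine (isCompact_closedBall x R).of_isClosed_subset ?_ inter_subset_right
    rw [hset]
    exact (H.smooth.1.continuousOn.mono hRU).preimage_isClosed_of_isClosed
      Metric.isClosed_closedBall isClosed_singleton
  filter_upwards [Metric.ball_mem_nhds x (half_pos hR)] with z hz
  rw [mem_ball_iff_norm] at hz
  obtain ⟨y, hy, hmin⟩ := hc.exists_isMinOn ⟨x, hx, Metric.mem_closedBall_self hR.le⟩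
    (f := fun y => ‖y - z‖) (by fun_prop)
  refine ⟨y, hy.1, fun w hw => ?_⟩
  by_cases hwR : w ∈ Metric.closedBall x R
  · exact hmin ⟨hw, hwR⟩
  · rw [mem_closedBall_iff_norm, not_le] at hwR
    have h1 : ‖y - z‖ ≤ ‖x - z‖ := hmin ⟨hx, Metric.mem_closedBall_self hR.le⟩
    have h2 : ‖w - x‖ ≤ ‖w - z‖ + ‖z - x‖ := norm_sub_le_norm_sub_add_norm_sub w z x
    rw [norm_sub_rev x z] at h1
    linarith

theorem infDist_eq_of_mem_nearestPoints {E : Type*} [NormedAddCommGroup E]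
    {M : Set E} {y z : E} (hy : y ∈ nearestPoints M z) :
    Metric.infDist z M = ‖z - y‖ := by
  refine le_antisymm ?_ ?_
  · rw [← dist_eq_norm]; exact Metric.infDist_le_dist_of_mem hy.1
  · refine (Metric.le_infDist ⟨y, hy.1⟩).2 fun w hw => ?_
    rw [dist_comm, dist_eq_norm, norm_sub_rev]
    exact hy.2 w hw

theorem eq_of_mem_nearestPoints_of_mem {E : Type*} [NormedAddCommGroup E]
    {M : Set E} {y z : E} (hy : y ∈ nearestPoints M z)
    (hz : z ∈ M) : y = z := by
  have := hy.2 z hz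
  rw [sub_self, norm_zero] at this
  exact sub_eq_zero.1 (norm_le_zero_iff.1 this)

theorem norm_sub_le_two_mul_of_mem_nearestPoints {E : Type*} [NormedAddCommGroup E]
    {M : Set E} {x y z : E}
    (hy : y ∈ nearestPoints M z) (hx : x ∈ M) : ‖y - x‖ ≤ 2 * ‖z - x‖ := by
  have h1 := hy.2 x hx
  rw [norm_sub_rev x z] at h1
  have := norm_sub_le_norm_sub_add_norm_sub y z x
  linarith

theorem sub_mem_normalSpaceAt_of_mem_nearestPoints {M : Set E} {y z : E}
    (hy : y ∈ nearestPoints M z) : z - y ∈ normalSpaceAt M y := by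
  refine (Submodule.mem_orthogonal _ _).2 fun v hv => ?_
  induction hv using Submodule.span_induction with
  | mem v hv =>
    obtain ⟨γ, hγ0, hγM, hγ⟩ := hv
    have hd : HasDerivAt (fun t => ‖γ t - z‖ ^ 2) (2 * inner ℝ (γ 0 - z) v) 0 :=
      (hγ.sub_const z).norm_sq
    have hmin : IsLocalMin (fun t => ‖γ t - z‖ ^ 2) 0 := by
      filter_upwards [hγM] with t ht
      have := hy.2 _ ht
      rw [hγ0]
      gcongr
    have h0 := hmin.hasDerivAt_eq_zero hd
    rw [hγ0, ← neg_sub z y, inner_neg_left, real_inner_comm] at h0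
    linarith
  | zero => simp
  | add v w _ _ hv hw => rw [inner_add_left, hv, hw, add_zero]
  | smul a v _ hv => rw [real_inner_smul_left, hv, mul_zero]

/-! ### Derivatives of consistent maps -/

/-- Near `x`, the value `φ y` approximates some nearest point of `M` to `y` up to
`o(dist (y, M))`.  Both an exact selection of nearest points and a first-order consistent map
have this property at the points of a submanifold; it includes the existence of nearest points. -/
def ApproximatesNearestPointsAt (M : Set E) (φ : E → E) (x : E) : Prop :=
  ∀ ε > (0 : ℝ), ∀ᶠ y in 𝓝 x, ∃ z ∈ nearestPoints M y, ‖φ y - z‖ ≤ ε * Metric.infDist y M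

theorem FirstOrderConsistent.approximatesNearestPointsAt [FiniteDimensional ℝ E] {p : ℕ}
    {M U : Set E} {φ : E → E} (hφ : FirstOrderConsistent M U φ) (hM : IsEmbeddedSubmanifold p M)
    {x : E} (hxU : x ∈ U) (hxM : x ∈ M) : ApproximatesNearestPointsAt M φ x := by
  obtain ⟨-, m, hm⟩ := hM
  obtain ⟨W, h, H⟩ := hm x hxM
  intro ε hε
  filter_upwards [hφ x ⟨hxU, hxM⟩ ε hε, H.eventually_exists_nearestPoints hxM] with y hy hne
  obtain ⟨z, hz⟩ := hne
  exact ⟨z, hz, hy z hz⟩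

theorem approximatesNearestPointsAt_of_mem_nearestPoints {E : Type*} [NormedAddCommGroup E]
    {M U : Set E} {φ : E → E}
    (hU : IsOpen U) (hφ : ∀ y ∈ U, φ y ∈ nearestPoints M y) {x : E} (hxU : x ∈ U) :
    ApproximatesNearestPointsAt M φ x := by
  intro ε hε
  filter_upwards [hU.mem_nhds hxU] with y hy
  refine ⟨φ y, hφ y hy, ?_⟩
  rw [sub_self, norm_zero]
  exact mul_nonneg hε.le Metric.infDist_nonneg

theorem ApproximatesNearestPointsAt.eventually_eq_self {E : Type*} [NormedAddCommGroup E]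
    {M : Set E} {φ : E → E} {x : E}
    (hφ : ApproximatesNearestPointsAt M φ x) : ∀ᶠ y in 𝓝 x, y ∈ M → φ y = y := by
  filter_upwards [hφ 1 one_pos] with y hy hyM
  obtain ⟨z, hz, hφz⟩ := hy
  rw [eq_of_mem_nearestPoints_of_mem hz hyM, Metric.infDist_zero_of_mem hyM, mul_zero] at hφz
  exact sub_eq_zero.1 (norm_le_zero_iff.1 hφz)

/-- For `n` normal to `M` at `x`, nearest points of `M` to `x + t n` differ from `x` by `o(t)`:
if `w` is their difference, then `‖w‖² ≤ 2 t ⟪w, n⟫`, and `⟪w, n⟫` is controlled by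
`D h x w = o(‖w‖)` because `n` is orthogonal to `ker (D h x)`. -/
theorem IsLocalDefiningFunction.eventually_norm_nearestPoints_sub_le [FiniteDimensional ℝ E]
    {p m : ℕ} {M U : Set E} {x : E} {h : E → EuclideanSpace ℝ (Fin m)}
    (H : IsLocalDefiningFunction p m M x U h) (hp : p ≠ 0) (hx : x ∈ M) {n : E}
    (hn : n ∈ normalSpaceAt M x) {ε : ℝ} (hε : 0 < ε) :
    ∀ᶠ t : ℝ in 𝓝 0, ∀ z ∈ nearestPoints M (x + t • n), ‖z - x‖ ≤ ε * |t| := by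
  have : CompleteSpace E := FiniteDimensional.complete ℝ E
  obtain ⟨B, hB⟩ := (fderiv ℝ h x).exists_rightInverse_of_surjective
    (LinearMap.range_eq_top.2 H.full_rank)
  have hd : HasFDerivAt h (fderiv ℝ h x) x :=
    (H.contDiffAt.differentiableAt (by exact_mod_cast hp)).hasFDerivAt
  have hh0 : h x = 0 := (H.zero_iff x H.mem).2 hx
  set b : ℝ := 2 * (‖B‖ * ‖n‖) + 1 with hb
  have hb0 : 0 < b := by positivity
  obtain ⟨r, hr, hsub⟩ := Metric.eventually_nhds_iff.1
    ((hd.isLittleO.def (div_pos hε hb0)).and (H.isOpen.mem_nhds H.mem))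
  have hsmall : ∀ᶠ t : ℝ in 𝓝 0, 2 * ‖t • n‖ < r := by
    have hc : ContinuousAt (fun t : ℝ => 2 * ‖t • n‖) 0 := by fun_prop
    exact hc.eventually (gt_mem_nhds (by simpa using hr))
  filter_upwards [hsmall] with t ht z hz
  set w := z - x with hw
  have hw2 : ‖w‖ ≤ 2 * ‖t • n‖ := by
    simpa using norm_sub_le_two_mul_of_mem_nearestPoints hz hx
  obtain ⟨hlin, hzU⟩ := hsub (y := z) (by rw [dist_eq_norm]; exact hw2.trans_lt ht)
  have hDw : ‖fderiv ℝ h x w‖ ≤ ε / b * ‖w‖ := by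
    rw [(H.zero_iff z hzU).2 hz.1, hh0, sub_zero, zero_sub, norm_neg] at hlin
    exact hlin
  have hker : w - B (fderiv ℝ h x w) ∈ tangentSpaceAt M x := by
    refine H.ker_le_tangentSpaceAt hp hx ?_
    have : fderiv ℝ h x (B (fderiv ℝ h x w)) = fderiv ℝ h x w :=
      congrArg (fun T => T (fderiv ℝ h x w)) hB
    simp [this]
  have hwn : |inner ℝ w n| ≤ ‖B‖ * ‖n‖ * (ε / b * ‖w‖) := by
    have h1 := Submodule.inner_right_of_mem_orthogonal hker hn
    rw [inner_sub_left, sub_eq_zero] at h1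
    rw [h1]
    calc |inner ℝ (B (fderiv ℝ h x w)) n| ≤ ‖B (fderiv ℝ h x w)‖ * ‖n‖ := abs_real_inner_le_norm _ _
      _ ≤ ‖B‖ * (ε / b * ‖w‖) * ‖n‖ := by
        gcongr
        exact (B.le_opNorm _).trans (by gcongr)
      _ = _ := by ring
  have hsq : ‖w‖ ^ 2 ≤ 2 * (t * inner ℝ w n) := by
    have h1 : ‖w - t • n‖ ≤ ‖t • n‖ := by
      have := hz.2 x hx
      rwa [show z - (x + t • n) = w - t • n by rw [hw]; abel, sub_add_cancel_left, norm_neg] at this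
    have h2 : ‖w - t • n‖ ^ 2 ≤ ‖t • n‖ ^ 2 := by gcongr
    rw [norm_sub_sq_real, real_inner_smul_right] at h2
    linarith
  have hsq' : ‖w‖ * ‖w‖ ≤ (ε * |t|) * ‖w‖ := by
    have h1 : t * inner ℝ w n ≤ |t| * |inner ℝ w n| := by
      rw [← abs_mul]; exact le_abs_self _
    have h2 : |t| * |inner ℝ w n| ≤ |t| * (‖B‖ * ‖n‖ * (ε / b * ‖w‖)) := by gcongr
    have h3 : 2 * (|t| * (‖B‖ * ‖n‖ * (ε / b * ‖w‖))) ≤ b * (|t| * (ε / b * ‖w‖)) := by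
      have : 0 ≤ |t| * (ε / b * ‖w‖) := by positivity
      rw [hb]
      nlinarith
    have h4 : b * (|t| * (ε / b * ‖w‖)) = ε * |t| * ‖w‖ := by
      field_simp
    nlinarith
  rcases (norm_nonneg w).eq_or_lt with h0 | h0
  · rw [← h0]; positivity
  · exact le_of_mul_le_mul_right hsq' h0

/-- A differentiable map which approximates nearest points of `M` to first order has the
orthogonal projection onto the tangent space as its derivative at points of `M`. -/
theorem ApproximatesNearestPointsAt.fderiv_eq [FiniteDimensional ℝ E] {p : ℕ} (hp : p ≠ 0)
    {M : Set E} (hM : IsEmbeddedSubmanifold p M) {φ : E → E} {x : E} (hx : x ∈ M)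
    (hφ : ApproximatesNearestPointsAt M φ x) (hd : DifferentiableAt ℝ φ x) :
    fderiv ℝ φ x = tangentProj M x := by
  obtain ⟨-, m, hm⟩ := hM
  obtain ⟨W, h, H⟩ := hm x hx
  have hfix := hφ.eventually_eq_self
  have hφx : φ x = x := hfix.self_of_nhds hx
  have htan : ∀ v ∈ tangentSpaceAt M x, fderiv ℝ φ x v = v := by
    intro v hv
    induction hv using Submodule.span_induction with
    | mem v hv =>
      obtain ⟨γ, rfl, hγM, hγ⟩ := hv
      have h1 := hd.hasFDerivAt.comp_hasDerivAt (0 : ℝ) hγ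
      refine h1.unique (hγ.congr_of_eventuallyEq ?_)
      filter_upwards [hγM, hγ.continuousAt.eventually hfix] with t ht hft
      exact hft ht
    | zero => simp
    | add v w _ _ hv hw => rw [map_add, hv, hw]
    | smul a v _ hv => rw [map_smul, hv]
  have hnor : ∀ n ∈ normalSpaceAt M x, fderiv ℝ φ x n = 0 := by
    intro n hn
    have hline : HasDerivAt (fun t : ℝ => x + t • n) n 0 := by
      simpa using ((hasDerivAt_id (0 : ℝ)).smul_const n).const_add x
    have h1 : HasDerivAt (fun t : ℝ => φ (x + t • n)) (fderiv ℝ φ x n) 0 := by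
      have : HasFDerivAt φ (fderiv ℝ φ x) (x + (0 : ℝ) • n) := by simpa using hd.hasFDerivAt
      exact this.comp_hasDerivAt (0 : ℝ) hline
    refine h1.unique ?_
    rw [hasDerivAt_iff_isLittleO]
    refine Asymptotics.isLittleO_iff.2 fun ε hε => ?_
    have hn1 : 0 < 2 * (‖n‖ + 1) := by positivity
    have hlim : Tendsto (fun t : ℝ => x + t • n) (𝓝 0) (𝓝 x) := by
      simpa [ContinuousAt] using hline.continuousAt
    filter_upwards [H.eventually_norm_nearestPoints_sub_le hp hx hn (half_pos hε),
      hlim.eventually (hφ _ (div_pos hε hn1))] with t hzt hzφ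
    obtain ⟨z, hz, hφz⟩ := hzφ
    have h2 : Metric.infDist (x + t • n) M ≤ |t| * ‖n‖ := by
      have := Metric.infDist_le_dist_of_mem (x := x + t • n) hx
      rwa [dist_eq_norm, add_sub_cancel_left, norm_smul, Real.norm_eq_abs] at this
    have h3 : ‖φ (x + t • n) - x‖ ≤ ε * |t| := by
      calc ‖φ (x + t • n) - x‖ ≤ ‖φ (x + t • n) - z‖ + ‖z - x‖ :=
            norm_sub_le_norm_sub_add_norm_sub _ _ _
        _ ≤ ε / (2 * (‖n‖ + 1)) * (|t| * (‖n‖ + 1)) + ε / 2 * |t| := by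
            refine add_le_add (hφz.trans ?_) (hzt z hz)
            gcongr
            exact h2.trans (by gcongr; linarith)
        _ = ε * |t| := by field_simp; ring
    simpa [hφx] using h3
  ext v
  have hv := Submodule.starProjection_add_starProjection_orthogonal (K := tangentSpaceAt M x) v
  conv_lhs => rw [← hv]
  have h0 : fderiv ℝ φ x ((tangentSpaceAt M x)ᗮ.starProjection v) = 0 :=
    hnor _ (Submodule.starProjection_apply_mem _ _)
  rw [map_add, htan _ (Submodule.starProjection_apply_mem _ _), h0, add_zero]
  rfl

/-! ### Local contraction towards the intersection -/

/-- A composition of two orthogonal projections is a strict contraction on the orthogonal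
complement of the intersection of their ranges. -/
theorem exists_norm_starProjection_comp_le [FiniteDimensional ℝ E] (S T : Submodule ℝ E) :
    ∃ c : ℝ, 0 ≤ c ∧ c < 1 ∧ ∀ n ∈ (S ⊓ T)ᗮ,
      ‖S.starProjection (T.starProjection n)‖ ≤ c * ‖n‖ := by
  have : ProperSpace E := FiniteDimensional.proper ℝ E
  have hc : IsCompact (Metric.sphere (0 : E) 1 ∩ ((S ⊓ T)ᗮ : Submodule ℝ E)) :=
    (isCompact_sphere 0 1).inter_right (Submodule.isClosed_orthogonal _)
  have hunit : ∀ n : E, n ≠ 0 → ‖‖n‖⁻¹ • n‖ = 1 := fun n hn => by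
    rw [norm_smul, norm_inv, norm_norm, inv_mul_cancel₀ (norm_ne_zero_iff.2 hn)]
  rcases (Metric.sphere (0 : E) 1 ∩ ((S ⊓ T)ᗮ : Submodule ℝ E)).eq_empty_or_nonempty with he | hne
  · refine ⟨0, le_rfl, one_pos, fun n hn => ?_⟩
    by_cases h0 : n = 0
    · simp [h0]
    · exact absurd (show ‖n‖⁻¹ • n ∈ (∅ : Set E) from
        he ▸ ⟨by simpa using hunit n h0, Submodule.smul_mem _ _ hn⟩) (notMem_empty _)
  · obtain ⟨e, ⟨he1, heN⟩, hmax⟩ := hc.exists_isMaxOn hne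
      (f := fun n => ‖S.starProjection (T.starProjection n)‖) (by fun_prop)
    have he1' : ‖e‖ = 1 := by simpa using he1
    refine ⟨‖S.starProjection (T.starProjection e)‖, norm_nonneg _, ?_, fun n hn => ?_⟩
    · have h1 := S.norm_starProjection_apply_le (T.starProjection e)
      have h2 := T.norm_starProjection_apply_le e
      by_contra! hge
      have heT : e ∈ T := (T.mem_iff_norm_starProjection e).2 (le_antisymm h2 (by linarith))
      rw [Submodule.starProjection_eq_self_iff.2 heT] at hge h1
      have heS : e ∈ S := (S.mem_iff_norm_starProjection e).2 (le_antisymm h1 (by linarith))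
      have h0 : inner ℝ e e = 0 := Submodule.inner_right_of_mem_orthogonal (K := S ⊓ T)
        ⟨heS, heT⟩ heN
      rw [inner_self_eq_zero.1 h0, norm_zero] at he1'
      exact zero_ne_one he1'
    · by_cases h0 : n = 0
      · simp [h0]
      have h1 : ‖S.starProjection (T.starProjection (‖n‖⁻¹ • n))‖ ≤ _ :=
        hmax ⟨by simpa using hunit n h0, Submodule.smul_mem _ _ hn⟩
      rw [map_smul, map_smul, norm_smul, norm_inv, norm_norm,
        inv_mul_le_iff₀ (norm_pos_iff.2 h0)] at h1
      rwa [mul_comm]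

/-- One step of the iteration from `z` contracts the distance to a nearest point `y` of `M`. -/
def ContractsToNearest (M : Set E) (φ : E → E) (c : ℝ) (z : E) : Prop :=
  ∃ y ∈ nearestPoints M z, ‖φ z - y‖ ≤ c * ‖z - y‖

/-- Near a point of `M` where the strict derivative of `φ` contracts the normal space, `φ`
contracts the distance to `M`: for a nearest point `y`, the vector `z - y` is normal to `M` at
`y`, hence nearly normal to `M` at `x`. -/
theorem IsLocalDefiningFunction.eventually_contractsToNearest [FiniteDimensional ℝ E]
    {p m : ℕ} {M U : Set E} {x : E} {h : E → EuclideanSpace ℝ (Fin m)}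
    (H : IsLocalDefiningFunction p m M x U h) (hp : p ≠ 0) (hx : x ∈ M)
    {φ : E → E} {D : E →L[ℝ] E} (hD : HasStrictFDerivAt φ D x)
    (hfix : ∀ᶠ y in 𝓝 x, y ∈ M → φ y = y) {c : ℝ} (hc : c < 1)
    (hcD : ∀ n ∈ normalSpaceAt M x, ‖D n‖ ≤ c * ‖n‖) (hc0 : 0 ≤ c) :
    ∃ c' : ℝ, 0 ≤ c' ∧ c' < 1 ∧ ∀ᶠ z in 𝓝 x, ContractsToNearest M φ c' z := by
  set ε : ℝ := (1 - c) / (2 * (‖D‖ + 1)) with hεdef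
  have hD0 : 0 < 2 * (‖D‖ + 1) := by positivity
  have hε : 0 < ε := div_pos (by linarith) hD0
  have hεeq : (‖D‖ + 1) * ε = (1 - c) / 2 := by rw [hεdef]; field_simp
  refine ⟨(1 + c) / 2, by linarith, by linarith, ?_⟩
  have hstrict := hD.isLittleO.def hε
  rw [nhds_prod_eq] at hstrict
  have hsmall := (eventually_norm_starProjection_normal_le H hp hε).and hfix
  obtain ⟨s, hs, t, ht, hst⟩ := Filter.mem_prod_iff.1 hstrict
  obtain ⟨r, hr, hball⟩ := Metric.eventually_nhds_iff.1 (hsmall.and ht)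
  filter_upwards [hs, H.eventually_exists_nearestPoints hx, Metric.ball_mem_nhds x (half_pos hr)]
    with z hzs hne hz
  obtain ⟨y, hy⟩ := hne
  rw [mem_ball_iff_norm] at hz
  have hyr : dist y x < r := by
    rw [dist_eq_norm]
    linarith [norm_sub_le_two_mul_of_mem_nearestPoints hy hx]
  obtain ⟨⟨hproj, hfy⟩, hyt⟩ := hball hyr
  refine ⟨y, hy, ?_⟩
  have hlin : ‖φ z - φ y - D (z - y)‖ ≤ ε * ‖z - y‖ := hst (show (z, y) ∈ s ×ˢ t from ⟨hzs, hyt⟩)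
  rw [hfy hy.1] at hlin
  set n := z - y with hn
  have hTn := hproj hy.1 n (sub_mem_normalSpaceAt_of_mem_nearestPoints hy)
  have hdec := Submodule.starProjection_add_starProjection_orthogonal (K := tangentSpaceAt M x) n
  have hDn : ‖D n‖ ≤ ‖D‖ * (ε * ‖n‖) + c * ‖n‖ := by
    conv_lhs => rw [← hdec]
    rw [map_add]
    refine (norm_add_le _ _).trans (add_le_add ?_ ?_)
    · exact (D.le_opNorm _).trans (by gcongr)
    · refine (hcD _ (Submodule.starProjection_apply_mem _ _)).trans ?_
      gcongr
      exact Submodule.norm_starProjection_apply_le _ _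
  calc ‖φ z - y‖ ≤ ‖φ z - y - D n‖ + ‖D n‖ := by
        simpa using norm_add_le (φ z - y - D n) (D n)
    _ ≤ ε * ‖n‖ + (‖D‖ * (ε * ‖n‖) + c * ‖n‖) := add_le_add hlin hDn
    _ = ((‖D‖ + 1) * ε + c) * ‖n‖ := by ring
    _ = (1 + c) / 2 * ‖n‖ := by rw [hεeq]; ring

/-! ### Geometric convergence of contracting iterations -/

section Contraction

variable {E : Type*} [NormedAddCommGroup E] {M : Set E} {φ : E → E} {c : ℝ} {z : E}

theorem ContractsToNearest.mono (h : ContractsToNearest M φ c z) {c' : ℝ} (hc : c ≤ c') :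
    ContractsToNearest M φ c' z := by
  obtain ⟨y, hy, hφ⟩ := h
  exact ⟨y, hy, hφ.trans (by gcongr)⟩

theorem ContractsToNearest.infDist_le (h : ContractsToNearest M φ c z) :
    Metric.infDist (φ z) M ≤ c * Metric.infDist z M := by
  obtain ⟨y, hy, hφ⟩ := h
  rw [infDist_eq_of_mem_nearestPoints hy]
  refine (Metric.infDist_le_dist_of_mem hy.1).trans ?_
  rwa [dist_eq_norm]

theorem ContractsToNearest.norm_sub_le (h : ContractsToNearest M φ c z) :
    ‖φ z - z‖ ≤ (1 + c) * Metric.infDist z M := by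
  obtain ⟨y, hy, hφ⟩ := h
  rw [infDist_eq_of_mem_nearestPoints hy]
  have := norm_sub_le_norm_sub_add_norm_sub (φ z) y z
  rw [norm_sub_rev y z] at this
  linarith

/-- The displacement of a contracting step bounds the distance to `M`. -/
theorem ContractsToNearest.infDist_le_norm_sub (h : ContractsToNearest M φ c z) :
    (1 - c) * Metric.infDist z M ≤ ‖φ z - z‖ := by
  obtain ⟨y, hy, hφ⟩ := h
  rw [infDist_eq_of_mem_nearestPoints hy]
  have := norm_sub_le_norm_sub_add_norm_sub z (φ z) y
  rw [norm_sub_rev z (φ z)] at this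
  linarith

theorem ContractsToNearest.mem_of_infDist_eq_zero (h : ContractsToNearest M φ c z)
    (h0 : Metric.infDist z M = 0) : z ∈ M := by
  obtain ⟨y, hy, -⟩ := h
  rw [infDist_eq_of_mem_nearestPoints hy] at h0
  rw [sub_eq_zero.1 (norm_eq_zero.1 h0)]
  exact hy.1

theorem norm_iterate_sub_le_of_contractsToNearest {x : E} {r : ℝ} (hc0 : 0 ≤ c) (hc1 : c < 1)
    (hφ : ∀ z ∈ Metric.ball x r, ContractsToNearest M φ c z)
    (hz : ‖z - x‖ + 2 * Metric.infDist z M / (1 - c) < r) (k : ℕ) :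
    φ^[k] z ∈ Metric.ball x r ∧ Metric.infDist (φ^[k] z) M ≤ c ^ k * Metric.infDist z M ∧
      ‖φ^[k] z - z‖ ≤ 2 * Metric.infDist z M / (1 - c) * (1 - c ^ k) := by
  have hc : 0 < 1 - c := by linarith
  have hd : 0 ≤ Metric.infDist z M := Metric.infDist_nonneg
  have hB : 0 ≤ 2 * Metric.infDist z M / (1 - c) := by positivity
  have hball : ∀ w, ‖w - z‖ ≤ 2 * Metric.infDist z M / (1 - c) → w ∈ Metric.ball x r := by
    intro w hw
    rw [mem_ball_iff_norm]
    linarith [norm_sub_le_norm_sub_add_norm_sub w z x]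
  have hbound : ∀ k : ℕ, 2 * Metric.infDist z M / (1 - c) * (1 - c ^ k) ≤
      2 * Metric.infDist z M / (1 - c) := fun k =>
    mul_le_of_le_one_right hB (by linarith [pow_nonneg hc0 k])
  induction k with
  | zero => exact ⟨hball _ (by simpa using hB), by simp, by simp⟩
  | succ k ih =>
    obtain ⟨h1, h2, h3⟩ := ih
    have hk := hφ _ h1
    have hstep : ‖φ^[k + 1] z - z‖ ≤ 2 * Metric.infDist z M / (1 - c) * (1 - c ^ (k + 1)) := by
      rw [Function.iterate_succ_apply']
      calc ‖φ (φ^[k] z) - z‖ ≤ ‖φ (φ^[k] z) - φ^[k] z‖ + ‖φ^[k] z - z‖ :=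
            norm_sub_le_norm_sub_add_norm_sub _ _ _
        _ ≤ 2 * (c ^ k * Metric.infDist z M) +
            2 * Metric.infDist z M / (1 - c) * (1 - c ^ k) := by
            refine add_le_add (hk.norm_sub_le.trans ?_) h3
            exact mul_le_mul (by linarith) h2 Metric.infDist_nonneg (by norm_num)
        _ = _ := by field_simp; ring
    refine ⟨hball _ (hstep.trans (hbound _)), ?_, hstep⟩
    rw [Function.iterate_succ_apply', pow_succ', mul_assoc]
    exact hk.infDist_le.trans (by gcongr)

/-- If `φ` contracts the distance to `M` on a ball, then the iterates from a point close to the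
centre, compared with its distance to `M`, converge geometrically to a point of `M`. -/
theorem exists_tendsto_iterate_of_contractsToNearest [CompleteSpace E] {x : E} {r : ℝ}
    (hc0 : 0 ≤ c) (hc1 : c < 1) (hφ : ∀ z ∈ Metric.ball x r, ContractsToNearest M φ c z)
    (hz : ‖z - x‖ + 2 * Metric.infDist z M / (1 - c) < r) :
    ∃ a ∈ M ∩ Metric.ball x r, Tendsto (fun k => φ^[k] z) atTop (𝓝 a) ∧
      ∀ k : ℕ, ‖a - φ^[k] z‖ ≤ 2 * Metric.infDist z M / (1 - c) * c ^ k := by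
  have hit := norm_iterate_sub_le_of_contractsToNearest hc0 hc1 hφ hz
  have hstep : ∀ k, dist (φ^[k] z) (φ^[k + 1] z) ≤ 2 * Metric.infDist z M * c ^ k := by
    intro k
    obtain ⟨h1, h2, -⟩ := hit k
    rw [dist_comm, dist_eq_norm, Function.iterate_succ_apply']
    refine (hφ _ h1).norm_sub_le.trans ?_
    rw [mul_assoc, mul_comm (Metric.infDist z M)]
    exact mul_le_mul (by linarith) h2 Metric.infDist_nonneg (by norm_num)
  obtain ⟨a, ha⟩ := cauchySeq_tendsto_of_complete (cauchySeq_of_le_geometric c _ hc1 hstep)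
  have hdist : ∀ k : ℕ, ‖a - φ^[k] z‖ ≤ 2 * Metric.infDist z M / (1 - c) * c ^ k := by
    intro k
    have := dist_le_of_le_geometric_of_tendsto c _ hc1 hstep ha k
    rw [dist_comm, dist_eq_norm] at this
    rwa [div_mul_eq_mul_div]
  have haball : a ∈ Metric.ball x r := by
    have h0 := hdist 0
    rw [pow_zero, mul_one, Function.iterate_zero_apply] at h0
    rw [mem_ball_iff_norm]
    linarith [norm_sub_le_norm_sub_add_norm_sub a z x]
  refine ⟨a, ⟨(hφ a haball).mem_of_infDist_eq_zero ?_, haball⟩, ha, hdist⟩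
  have h1 : Tendsto (fun k => Metric.infDist (φ^[k] z) M) atTop (𝓝 (Metric.infDist a M)) :=
    ((Metric.continuous_infDist_pt M).tendsto a).comp ha
  have h2 : Tendsto (fun k => c ^ k * Metric.infDist z M) atTop (𝓝 0) := by
    simpa using (tendsto_pow_atTop_nhds_zero_of_lt_one hc0 hc1).mul_const (Metric.infDist z M)
  exact le_antisymm (le_of_tendsto_of_tendsto' h1 h2 fun k => (hit k).2.1) Metric.infDist_nonneg

/-- Local contraction factors near the points of a compact set can be replaced by a common one. -/
theorem exists_eventually_nhdsSet_contractsToNearest {K : Set E} (hK : IsCompact K)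
    (h : ∀ x ∈ K, ∃ c : ℝ, 0 ≤ c ∧ c < 1 ∧ ∀ᶠ z in 𝓝 x, ContractsToNearest M φ c z) :
    ∃ c : ℝ, 0 ≤ c ∧ c < 1 ∧ ∀ᶠ z in 𝓝ˢ K, ContractsToNearest M φ c z := by
  refine hK.induction_on
    (p := fun s => ∃ c : ℝ, 0 ≤ c ∧ c < 1 ∧ ∀ᶠ z in 𝓝ˢ s, ContractsToNearest M φ c z)
    ⟨0, le_rfl, one_pos, by simp⟩ ?_ ?_ ?_
  · rintro s t hst ⟨c, hc0, hc1, hc⟩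
    exact ⟨c, hc0, hc1, hc.filter_mono (nhdsSet_mono hst)⟩
  · rintro s t ⟨c, hc0, hc1, hc⟩ ⟨d, hd0, hd1, hd⟩
    refine ⟨max c d, le_max_of_le_left hc0, max_lt hc1 hd1, ?_⟩
    rw [nhdsSet_union]
    exact eventually_sup.2 ⟨hc.mono fun z hz => hz.mono (le_max_left _ _),
      hd.mono fun z hz => hz.mono (le_max_right _ _)⟩
  · intro x hx
    obtain ⟨c, hc0, hc1, hc⟩ := h x hx
    obtain ⟨s, hs, hso, hxs⟩ := eventually_nhds_iff.1 hc
    refine ⟨s, mem_nhdsWithin_of_mem_nhds (hso.mem_nhds hxs), c, hc0, hc1, ?_⟩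
    filter_upwards [hso.mem_nhdsSet.2 Subset.rfl] with z hz using hs z hz

end Contraction

/-! ### Second-order tangential accuracy -/

/-- Uniformly in `x ∈ K` and `η ∈ T x`, every point within `O(‖η‖²)` of `x + η` is mapped by `φ`
to a point within `O(‖η‖²)` of `x + η`, and the displacement has a component in `T x` of size
`o(‖η‖²)`. -/
def TangentiallySecondOrder [FiniteDimensional ℝ E] (K : Set E) (T : E → Submodule ℝ E)
    (φ : E → E) : Prop :=
  ∀ C₀ : ℝ, 0 ≤ C₀ →
    (∃ C₁ : ℝ, 0 ≤ C₁ ∧ ∃ r > (0 : ℝ), ∀ x ∈ K, ∀ η ∈ T x, ∀ u : E, ‖u - η‖ ≤ C₀ * ‖η‖ ^ 2 →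
      ‖η‖ < r → ‖φ (x + u) - (x + η)‖ ≤ C₁ * ‖η‖ ^ 2) ∧
    ∀ ε > (0 : ℝ), ∃ r > (0 : ℝ), ∀ x ∈ K, ∀ η ∈ T x, ∀ u : E, ‖u - η‖ ≤ C₀ * ‖η‖ ^ 2 →
      ‖η‖ < r → ‖(T x).starProjection (φ (x + u) - (x + u))‖ ≤ ε * ‖η‖ ^ 2

theorem exists_norm_comparable_of_norm_sub_le_sq {E : Type*} [NormedAddCommGroup E] {C₀ : ℝ}
    (hC₀ : 0 ≤ C₀) {R : ℝ} (hR : 0 < R) :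
    ∃ r > (0 : ℝ), ∀ η u : E, ‖u - η‖ ≤ C₀ * ‖η‖ ^ 2 → ‖η‖ < r →
      ‖u‖ < R ∧ ‖u‖ ≤ 2 * ‖η‖ ∧ ‖η‖ ≤ 2 * ‖u‖ := by
  refine ⟨min (R / 2) (1 / (2 * (C₀ + 1))), lt_min (by positivity) (by positivity), ?_⟩
  intro η u hu hη
  obtain ⟨h1, h2⟩ := lt_min_iff.1 hη
  have h3 : ‖u - η‖ ≤ ‖η‖ / 2 := by
    rw [lt_div_iff₀ (by positivity)] at h2
    nlinarith [norm_nonneg η]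
  have h4 := norm_sub_norm_le u η
  have h5 := norm_sub_norm_le η u
  rw [norm_sub_rev η u] at h5
  exact ⟨by linarith, by linarith [norm_nonneg η], by linarith⟩

/-- The residual decomposition makes `φ` second-order accurate along every family of subspaces
of the tangent spaces: the points considered are tangential up to `O(‖η‖²)`, so that the residual
bounds apply with the modulus `t ↦ 4 C₀ t`. -/
theorem HasResidualDecomposition.tangentiallySecondOrder [FiniteDimensional ℝ E] {p : ℕ}
    {M K : Set E} {δ : ℝ} {φ : E → E} (h : HasResidualDecomposition p M K δ φ) (hδ : 0 < δ)
    {T : E → Submodule ℝ E} (hT : ∀ x ∈ K, T x ≤ tangentSpaceAt M x) :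
    TangentiallySecondOrder K T φ := by
  obtain ⟨RN, RT, hdec, -, -, hres⟩ := h
  intro C₀ hC₀
  have hω : Tendsto (fun t : ℝ => 4 * C₀ * t) (𝓝[>] 0) (𝓝 0) := by
    have : Tendsto (fun t : ℝ => 4 * C₀ * t) (𝓝 0) (𝓝 (4 * C₀ * 0)) :=
      (continuous_const.mul continuous_id).tendsto 0
    rw [mul_zero] at this
    exact this.mono_left nhdsWithin_le_nhds
  obtain ⟨⟨C, r₁, hr₁, hN⟩, hTan⟩ := hres _ hω
  have hnormal : ∀ x ∈ K, ∀ η ∈ T x, ∀ u : E, ‖u - η‖ ≤ C₀ * ‖η‖ ^ 2 → ‖η‖ ≤ 2 * ‖u‖ →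
      ‖normalProj M x u‖ ≤ 4 * C₀ * ‖u‖ * ‖u‖ := by
    intro x hx η hη u hu hηu
    have h0 : normalProj M x η = 0 :=
      Submodule.starProjection_orthogonal_apply_eq_zero (hT x hx hη)
    have h1 : normalProj M x u = normalProj M x (u - η) := by rw [map_sub, h0, sub_zero]
    calc ‖normalProj M x u‖ ≤ ‖u - η‖ := by
          rw [h1]; exact Submodule.norm_starProjection_apply_le _ _
      _ ≤ C₀ * (2 * ‖u‖) ^ 2 := hu.trans (by gcongr)
      _ = _ := by ring
  constructor
  · obtain ⟨r₂, hr₂, hT1⟩ := hTan 1 one_pos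
    obtain ⟨r, hr, hcomp⟩ := exists_norm_comparable_of_norm_sub_le_sq (E := E) hC₀
      (lt_min hδ (lt_min hr₁ hr₂))
    refine ⟨C₀ + (|C| * 4 + 4), by positivity, r, hr, fun x hx η hη u hu hηr => ?_⟩
    obtain ⟨huR, hu2, hηu⟩ := hcomp η u hu hηr
    obtain ⟨huδ, hu1', hu2'⟩ : ‖u‖ < δ ∧ ‖u‖ < r₁ ∧ ‖u‖ < r₂ := by simpa using huR
    have hub : u ∈ Metric.ball (0 : E) δ := by simpa using huδ
    obtain ⟨-, -, heq⟩ := hdec x hx u hub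
    have hnu := hnormal x hx η hη u hu hηu
    have hPη : tangentProj M x η = η := Submodule.starProjection_eq_self_iff.2 (hT x hx hη)
    have hsplit : φ (x + u) - (x + η) = tangentProj M x (u - η) + (RN x u + RT x u) := by
      rw [heq, map_sub, hPη]; abel
    have hsq : ‖u‖ ^ 2 ≤ 4 * ‖η‖ ^ 2 := by nlinarith [norm_nonneg u]
    have hb1 : ‖RN x u‖ ≤ |C| * (4 * ‖η‖ ^ 2) :=
      (hN x hx u hub hu1' hnu).trans
        (mul_le_mul (le_abs_self C) hsq (by positivity) (abs_nonneg C))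
    have hb2 : ‖RT x u‖ ≤ 4 * ‖η‖ ^ 2 := (hT1 x hx u hub hu2' hnu).trans (by linarith)
    have hb3 : ‖tangentProj M x (u - η)‖ ≤ C₀ * ‖η‖ ^ 2 :=
      (Submodule.norm_starProjection_apply_le _ _).trans hu
    rw [hsplit]
    have h1 := norm_add_le (tangentProj M x (u - η)) (RN x u + RT x u)
    have h2 := norm_add_le (RN x u) (RT x u)
    linarith
  · intro ε hε
    obtain ⟨r₂, hr₂, hT1⟩ := hTan (ε / 4) (by positivity)
    obtain ⟨r, hr, hcomp⟩ := exists_norm_comparable_of_norm_sub_le_sq (E := E) hC₀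
      (lt_min hδ hr₂)
    refine ⟨r, hr, fun x hx η hη u hu hηr => ?_⟩
    obtain ⟨huR, hu2, hηu⟩ := hcomp η u hu hηr
    obtain ⟨huδ, hu2'⟩ : ‖u‖ < δ ∧ ‖u‖ < r₂ := by simpa using huR
    have hub : u ∈ Metric.ball (0 : E) δ := by simpa using huδ
    obtain ⟨hRN, -, heq⟩ := hdec x hx u hub
    -- The displacement is the tangential residual up to vectors normal to `M`.
    have hsplit : φ (x + u) - (x + u) = RT x u + (RN x u - (u - tangentProj M x u)) := by
      rw [heq]; abel
    have horth : RN x u - (u - tangentProj M x u) ∈ (T x)ᗮ :=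
      Submodule.orthogonal_le (hT x hx) (Submodule.sub_mem _ hRN
        (Submodule.sub_starProjection_mem_orthogonal u))
    rw [hsplit, map_add, (Submodule.starProjection_apply_eq_zero_iff _).2 horth, add_zero]
    have hsq : ‖u‖ ^ 2 ≤ 4 * ‖η‖ ^ 2 := by nlinarith [norm_nonneg u]
    calc ‖(T x).starProjection (RT x u)‖ ≤ ‖RT x u‖ := Submodule.norm_starProjection_apply_le _ _
      _ ≤ ε / 4 * ‖u‖ ^ 2 := hT1 x hx u hub hu2' (hnormal x hx η hη u hu hηu)
      _ ≤ ε / 4 * (4 * ‖η‖ ^ 2) := by gcongr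
      _ = ε * ‖η‖ ^ 2 := by ring

theorem TangentiallySecondOrder.comp [FiniteDimensional ℝ E] {K : Set E}
    {T : E → Submodule ℝ E} {φ₁ φ₂ : E → E} (h₁ : TangentiallySecondOrder K T φ₁)
    (h₂ : TangentiallySecondOrder K T φ₂) : TangentiallySecondOrder K T (φ₁ ∘ φ₂) := by
  intro C₀ hC₀
  obtain ⟨⟨C, hC, r₂, hr₂, hb₂⟩, ht₂⟩ := h₂ C₀ hC₀
  obtain ⟨⟨C', hC', r₁, hr₁, hb₁⟩, ht₁⟩ := h₁ C hC
  have hmid : ∀ x η u : E, ‖φ₂ (x + u) - (x + η)‖ ≤ C * ‖η‖ ^ 2 →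
      ‖(φ₂ (x + u) - x) - η‖ ≤ C * ‖η‖ ^ 2 := fun x η u h => by rwa [sub_sub]
  refine ⟨⟨C', hC', min r₁ r₂, lt_min hr₁ hr₂, fun x hx η hη u hu hηr => ?_⟩, fun ε hε => ?_⟩
  · obtain ⟨hη1, hη2⟩ := lt_min_iff.1 hηr
    have := hb₁ x hx η hη _ (hmid x η u (hb₂ x hx η hη u hu hη2)) hη1
    rwa [add_sub_cancel] at this
  · obtain ⟨s₂, hs₂, ht₂⟩ := ht₂ (ε / 2) (half_pos hε)
    obtain ⟨s₁, hs₁, ht₁⟩ := ht₁ (ε / 2) (half_pos hε)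
    refine ⟨min r₂ (min s₁ s₂), lt_min hr₂ (lt_min hs₁ hs₂), fun x hx η hη u hu hηr => ?_⟩
    obtain ⟨hη2, hη1⟩ := lt_min_iff.1 hηr
    obtain ⟨hηs1, hηs2⟩ := lt_min_iff.1 hη1
    have hA := ht₁ x hx η hη _ (hmid x η u (hb₂ x hx η hη u hu hη2)) hηs1
    have hB := ht₂ x hx η hη u hu hηs2
    rw [add_sub_cancel] at hA
    calc ‖(T x).starProjection ((φ₁ ∘ φ₂) (x + u) - (x + u))‖
        = ‖(T x).starProjection (φ₁ (φ₂ (x + u)) - φ₂ (x + u)) +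
            (T x).starProjection (φ₂ (x + u) - (x + u))‖ := by
          rw [← map_add, sub_add_sub_cancel]; rfl
      _ ≤ ε / 2 * ‖η‖ ^ 2 + ε / 2 * ‖η‖ ^ 2 := (norm_add_le _ _).trans (add_le_add hA hB)
      _ = ε * ‖η‖ ^ 2 := by ring

/-! ### The alternating iteration -/

theorem IntersectCleanlyAt.exists_isLocalDefiningFunction {p : ℕ} {M₁ M₂ : Set E} {x : E}
    (h : IntersectCleanlyAt p M₁ M₂ x) :
    ∃ (m : ℕ) (W : Set E) (f : E → EuclideanSpace ℝ (Fin m)),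
      IsLocalDefiningFunction p m (M₁ ∩ M₂) x W f := by
  obtain ⟨hx, V, hV, hxV, ⟨-, m, hm⟩, -⟩ := h
  obtain ⟨W, f, H⟩ := hm x ⟨hx, hxV⟩
  exact ⟨m, _, f, H.of_inter_open hV hxV⟩

theorem IntersectCleanlyAt.tangentSpaceAt_inter {p : ℕ} {M₁ M₂ : Set E} {x : E}
    (h : IntersectCleanlyAt p M₁ M₂ x) :
    tangentSpaceAt (M₁ ∩ M₂) x = tangentSpaceAt M₁ x ⊓ tangentSpaceAt M₂ x := by
  obtain ⟨hx, V, -, hxV, -, hT⟩ := h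
  exact hT x ⟨hx, hxV⟩

namespace IsAlternatingFramework

variable {p : ℕ} {M₁ M₂ U : Set E} {φ₁ φ₂ : E → E} {x : E}

theorem approximatesNearestPointsAt₁ [FiniteDimensional ℝ E]
    (h : IsAlternatingFramework p M₁ M₂ U φ₁ φ₂) (hM : IsEmbeddedSubmanifold p M₁)
    (hxU : x ∈ U) (hx : x ∈ M₁) : ApproximatesNearestPointsAt M₁ φ₁ x := by
  rcases h.alternatives with h1 | h1 | h1
  · exact approximatesNearestPointsAt_of_mem_nearestPoints h.isOpen h1.1 hxU
  · exact h1.2.approximatesNearestPointsAt hM hxU hx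
  · exact h1.1.approximatesNearestPointsAt hM hxU hx

theorem approximatesNearestPointsAt₂ [FiniteDimensional ℝ E]
    (h : IsAlternatingFramework p M₁ M₂ U φ₁ φ₂) (hM : IsEmbeddedSubmanifold p M₂)
    (hxU : x ∈ U) (hx : x ∈ M₂) : ApproximatesNearestPointsAt M₂ φ₂ x := by
  rcases h.alternatives with h1 | h1 | h1
  · exact h1.2.approximatesNearestPointsAt hM hxU hx
  · exact approximatesNearestPointsAt_of_mem_nearestPoints h.isOpen h1.1 hxU
  · exact h1.2.1.approximatesNearestPointsAt hM hxU hx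

theorem hasStrictFDerivAt₁ [FiniteDimensional ℝ E]
    (h : IsAlternatingFramework p M₁ M₂ U φ₁ φ₂) (hp : 2 ≤ p) (hM : IsEmbeddedSubmanifold p M₁)
    (hxU : x ∈ U) (hx : x ∈ M₁) : HasStrictFDerivAt φ₁ (tangentProj M₁ x) x := by
  have hs : HasStrictFDerivAt φ₁ (fderiv ℝ φ₁ x) x :=
    (h.smooth₁.contDiffAt (h.isOpen.mem_nhds hxU)).hasStrictFDerivAt
      (by exact_mod_cast (by omega : p - 1 ≠ 0))
  rwa [(h.approximatesNearestPointsAt₁ hM hxU hx).fderiv_eq (by omega) hM hx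
    hs.differentiableAt] at hs

theorem hasStrictFDerivAt₂ [FiniteDimensional ℝ E]
    (h : IsAlternatingFramework p M₁ M₂ U φ₁ φ₂) (hp : 2 ≤ p) (hM : IsEmbeddedSubmanifold p M₂)
    (hxU : x ∈ U) (hx : x ∈ M₂) : HasStrictFDerivAt φ₂ (tangentProj M₂ x) x := by
  have hs : HasStrictFDerivAt φ₂ (fderiv ℝ φ₂ x) x :=
    (h.smooth₂.contDiffAt (h.isOpen.mem_nhds hxU)).hasStrictFDerivAt
      (by exact_mod_cast (by omega : p - 1 ≠ 0))
  rwa [(h.approximatesNearestPointsAt₂ hM hxU hx).fderiv_eq (by omega) hM hx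
    hs.differentiableAt] at hs

theorem apply₂_eq [FiniteDimensional ℝ E]
    (h : IsAlternatingFramework p M₁ M₂ U φ₁ φ₂) (hM : IsEmbeddedSubmanifold p M₂)
    (hxU : x ∈ U) (hx : x ∈ M₂) : φ₂ x = x :=
  (h.approximatesNearestPointsAt₂ hM hxU hx).eventually_eq_self.self_of_nhds hx

/-- Near a point of clean intersection, the alternating map contracts the distance to the
intersection. -/
theorem exists_eventually_contractsToNearest [FiniteDimensional ℝ E]
    (h : IsAlternatingFramework p M₁ M₂ U φ₁ φ₂) (hp : 2 ≤ p)
    (hM₁ : IsEmbeddedSubmanifold p M₁) (hM₂ : IsEmbeddedSubmanifold p M₂) (hxU : x ∈ U)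
    (hclean : IntersectCleanlyAt p M₁ M₂ x) :
    ∃ c : ℝ, 0 ≤ c ∧ c < 1 ∧ ∀ᶠ z in 𝓝 x, ContractsToNearest (M₁ ∩ M₂) (φ₁ ∘ φ₂) c z := by
  obtain ⟨hx₁, hx₂⟩ := hclean.1
  obtain ⟨m, W, f, H⟩ := hclean.exists_isLocalDefiningFunction
  obtain ⟨c, hc0, hc1, hc⟩ :=
    exists_norm_starProjection_comp_le (tangentSpaceAt M₁ x) (tangentSpaceAt M₂ x)
  have hφ₂x := h.apply₂_eq hM₂ hxU hx₂
  have hD₁ : HasStrictFDerivAt φ₁ (tangentProj M₁ x) (φ₂ x) := by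
    rw [hφ₂x]; exact h.hasStrictFDerivAt₁ hp hM₁ hxU hx₁
  refine H.eventually_contractsToNearest (by omega) ⟨hx₁, hx₂⟩
    (hD₁.comp x (h.hasStrictFDerivAt₂ hp hM₂ hxU hx₂)) ?_ hc1 ?_ hc0
  · filter_upwards [(h.approximatesNearestPointsAt₁ hM₁ hxU hx₁).eventually_eq_self,
      (h.approximatesNearestPointsAt₂ hM₂ hxU hx₂).eventually_eq_self] with y h1 h2 hy
    rw [Function.comp_apply, h2 hy.2, h1 hy.1]
  · intro n hn
    rw [normalSpaceAt, hclean.tangentSpaceAt_inter] at hn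
    exact hc n hn

end IsAlternatingFramework

theorem norm_starProjection_iterate_sub_le [FiniteDimensional ℝ E] (S : Submodule ℝ E)
    {φ : E → E} {z : E} {b : ℝ}
    (hb : ∀ k : ℕ, ‖S.starProjection (φ (φ^[k] z) - φ^[k] z)‖ ≤ b) (k : ℕ) :
    ‖S.starProjection (φ^[k] z - z)‖ ≤ k * b := by
  induction k with
  | zero => simp
  | succ k ih =>
    rw [Function.iterate_succ_apply', ← sub_add_sub_cancel _ (φ^[k] z) z, map_add]
    refine (norm_add_le _ _).trans ((add_le_add (hb k) ih).trans_eq ?_)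
    push_cast
    ring

end

theorem mainTheorem6
    {E : Type*} [NormedAddCommGroup E] [InnerProductSpace ℝ E] [FiniteDimensional ℝ E]
    (p : ℕ) (hp : 3 ≤ p)
    (M₁ M₂ : Set E) (hM₁ : IsEmbeddedSubmanifold p M₁) (hM₂ : IsEmbeddedSubmanifold p M₂)
    (xbar : E) (Ω K U : Set E)
    (hΩ : ∃ O : Set E, IsOpen O ∧ Ω = M₁ ∩ M₂ ∩ O) (hxbar : xbar ∈ Ω)
    (hK : K = closure Ω ∩ (M₁ ∩ M₂)) (hKc : IsCompact K) (hKU : K ⊆ U)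
    (hclean : ∀ x ∈ K, IntersectCleanlyAt p M₁ M₂ x)
    (φ₁ φ₂ : E → E) (hφ : IsAlternatingFramework p M₁ M₂ U φ₁ φ₂)
    (δ : ℝ) (hδ : 0 < δ) (hδU : Metric.thickening δ K ⊆ U)
    (hR : ResidualAssumption p M₁ M₂ K δ φ₁ φ₂) :
    ∃ ρ > (0 : ℝ), ∃ ψ : E → E → E,
      -- the iterates are well defined and converge to the limit point `ψ x η`
      (∀ x ∈ K, ∀ η ∈ tangentSpaceAt (M₁ ∩ M₂) x, ‖η‖ ≤ ρ →
        (∀ k : ℕ, (φ₁ ∘ φ₂)^[k] (x + η) ∈ Metric.thickening δ K ∧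
          φ₂ ((φ₁ ∘ φ₂)^[k] (x + η)) ∈ Metric.thickening δ K) ∧
        Tendsto (fun k : ℕ => (φ₁ ∘ φ₂)^[k] (x + η)) atTop (𝓝 (ψ x η)) ∧
        ψ x η ∈ M₁ ∩ M₂ ∩ Metric.thickening δ K) ∧
      -- the normal error is `O(‖η‖²)`, uniformly in `x ∈ K`
      (∃ C : ℝ, ∀ x ∈ K, ∀ η ∈ tangentSpaceAt (M₁ ∩ M₂) x, ‖η‖ ≤ ρ →
        ‖normalProj (M₁ ∩ M₂) x (ψ x η - (x + η))‖ ≤ C * ‖η‖ ^ 2) ∧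
      -- the tangential error is `o(‖η‖²)`, uniformly in `x ∈ K`
      (∀ ε > (0 : ℝ), ∃ r > (0 : ℝ), ∀ x ∈ K, ∀ η ∈ tangentSpaceAt (M₁ ∩ M₂) x,
        ‖η‖ ≤ ρ → ‖η‖ < r →
        ‖tangentProj (M₁ ∩ M₂) x (ψ x η - (x + η))‖ ≤ ε * ‖η‖ ^ 2) := by
  have : CompleteSpace E := FiniteDimensional.complete ℝ E
  set φ : E → E := φ₁ ∘ φ₂ with hφdef
  set M : Set E := M₁ ∩ M₂ with hMdef
  have hso : TangentiallySecondOrder K (tangentSpaceAt M) φ :=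
    (hR.residual₁.tangentiallySecondOrder hδ fun x hx =>
      (hclean x hx).tangentSpaceAt_inter.le.trans inf_le_left).comp
    (hR.residual₂.tangentiallySecondOrder hδ fun x hx =>
      (hclean x hx).tangentSpaceAt_inter.le.trans inf_le_right)
  -- A neighbourhood of `K` of uniform radius on which one step is well defined and contracting.
  obtain ⟨c, hc0, hc1, hc⟩ := exists_eventually_nhdsSet_contractsToNearest hKc fun x hx =>
    hφ.exists_eventually_contractsToNearest (by omega) hM₁ hM₂ (hKU hx) (hclean x hx)
  have hφ₂K : ∀ᶠ z in 𝓝ˢ K, φ₂ z ∈ Metric.thickening δ K := by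
    rw [eventually_nhdsSet_iff_forall]
    intro x hx
    have hx₂ := (hclean x hx).1.2
    refine (hφ.hasStrictFDerivAt₂ (by omega) hM₂ (hKU hx) hx₂).continuousAt.eventually
      (Metric.isOpen_thickening.mem_nhds ?_)
    rw [hφ.apply₂_eq hM₂ (hKU hx) hx₂]
    exact Metric.self_subset_thickening hδ K hx
  obtain ⟨r₀, hr₀, hnear⟩ := (Metric.hasBasis_nhdsSet_thickening hKc).mem_iff.1
    (hc.and (hφ₂K.and (Metric.thickening_mem_nhdsSet K hδ)))
  have hball : ∀ x ∈ K, ∀ z ∈ Metric.ball x r₀, ContractsToNearest M φ c z ∧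
      φ₂ z ∈ Metric.thickening δ K ∧ z ∈ Metric.thickening δ K := fun x hx z hz =>
    hnear (Metric.ball_subset_thickening hx r₀ hz)
  obtain ⟨⟨C₁, hC₁, r₁, hr₁, hstep⟩, -⟩ := hso 0 le_rfl
  have hc' : 0 < 1 - c := by linarith
  -- `B ‖η‖²` bounds the total length of the orbit of `x + η`.
  set B : ℝ := 2 * (C₁ / (1 - c)) / (1 - c) with hB
  have hB0 : 0 ≤ B := by positivity
  set ρ : ℝ := min (min (r₁ / 2) (r₀ / 2)) (min 1 (r₀ / (2 * (1 + B)))) with hρ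
  have hρ0 : 0 < ρ := by
    refine lt_min (lt_min ?_ ?_) (lt_min one_pos ?_) <;> positivity
  have hρr₁ : ρ < r₁ := by
    have : ρ ≤ r₁ / 2 := (min_le_left _ _).trans (min_le_left _ _)
    linarith
  have hρr₀ : ρ < r₀ := by
    have : ρ ≤ r₀ / 2 := (min_le_left _ _).trans (min_le_right _ _)
    linarith
  have hρB : ρ + B * ρ ^ 2 < r₀ := by
    have h1 : ρ ≤ 1 := (min_le_right _ _).trans (min_le_left _ _)
    have h2 : ρ ≤ r₀ / (2 * (1 + B)) := (min_le_right _ _).trans (min_le_right _ _)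
    rw [le_div_iff₀ (by positivity)] at h2
    have h3 : B * ρ ^ 2 ≤ B * ρ := by
      have : ρ ^ 2 ≤ ρ := by nlinarith
      gcongr
    nlinarith
  have hlen : ∀ x ∈ K, ∀ η ∈ tangentSpaceAt M x, ‖η‖ ≤ ρ →
      2 * Metric.infDist (x + η) M / (1 - c) ≤ B * ‖η‖ ^ 2 := by
    intro x hx η hη hηρ
    have h1 := hstep x hx η hη η (by simp) (hηρ.trans_lt hρr₁)
    have h2 := (hball x hx (x + η) (by simpa using hηρ.trans_lt hρr₀)).1.infDist_le_norm_sub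
    have h3 : Metric.infDist (x + η) M ≤ C₁ / (1 - c) * ‖η‖ ^ 2 := by
      rw [div_mul_eq_mul_div, le_div_iff₀ hc']
      linarith
    calc 2 * Metric.infDist (x + η) M / (1 - c)
        ≤ 2 * (C₁ / (1 - c) * ‖η‖ ^ 2) / (1 - c) := by gcongr
      _ = B * ‖η‖ ^ 2 := by rw [hB]; ring
  have hstart : ∀ x ∈ K, ∀ η ∈ tangentSpaceAt M x, ‖η‖ ≤ ρ →
      ‖x + η - x‖ + 2 * Metric.infDist (x + η) M / (1 - c) < r₀ := by
    intro x hx η hη hηρ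
    rw [add_sub_cancel_left]
    have h1 := hlen x hx η hη hηρ
    have h2 : B * ‖η‖ ^ 2 ≤ B * ρ ^ 2 := by gcongr
    linarith
  have hlim : ∀ x ∈ K, ∀ η ∈ tangentSpaceAt M x, ‖η‖ ≤ ρ → ∃ a ∈ M ∩ Metric.ball x r₀,
      Tendsto (fun k => φ^[k] (x + η)) atTop (𝓝 a) ∧
      ∀ k : ℕ, ‖a - φ^[k] (x + η)‖ ≤ 2 * Metric.infDist (x + η) M / (1 - c) * c ^ k :=
    fun x hx η hη hηρ => exists_tendsto_iterate_of_contractsToNearest hc0 hc1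
      (fun z hz => (hball x hx z hz).1) (hstart x hx η hη hηρ)
  choose! ψ hψM hψlim hψdist using hlim
  have hψB : ∀ x ∈ K, ∀ η ∈ tangentSpaceAt M x, ‖η‖ ≤ ρ → ∀ k : ℕ,
      ‖ψ x η - φ^[k] (x + η)‖ ≤ B * c ^ k * ‖η‖ ^ 2 := by
    intro x hx η hη hηρ k
    refine (hψdist x hx η hη hηρ k).trans ?_
    calc _ ≤ B * ‖η‖ ^ 2 * c ^ k := by
          gcongr
          exact hlen x hx η hη hηρ
      _ = _ := by ring
  refine ⟨ρ, hρ0, ψ, fun x hx η hη hηρ => ⟨fun k => ?_, hψlim x hx η hη hηρ, ?_⟩,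
    ⟨B, fun x hx η hη hηρ => ?_⟩, fun ε hε => ?_⟩
  · have hk := (norm_iterate_sub_le_of_contractsToNearest hc0 hc1
      (fun z hz => (hball x hx z hz).1) (hstart x hx η hη hηρ) k).1
    exact ⟨(hball x hx _ hk).2.2, (hball x hx _ hk).2.1⟩
  · have := hψM x hx η hη hηρ
    exact ⟨this.1, (hball x hx _ this.2).2.2⟩
  · refine (Submodule.norm_starProjection_apply_le _ _).trans ?_
    simpa using hψB x hx η hη hηρ 0
  · -- All but the first `k` steps contribute at most `ε / 2 * ‖η‖²` by geometric convergence;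
    -- each of the first `k` steps contributes `o(‖η‖²)`.
    obtain ⟨k, hk⟩ : ∃ k : ℕ, B * c ^ k < ε / 2 := by
      have : Tendsto (fun k => B * c ^ k) atTop (𝓝 0) := by
        simpa using (tendsto_pow_atTop_nhds_zero_of_lt_one hc0 hc1).const_mul B
      exact (this.eventually (gt_mem_nhds (half_pos hε))).exists
    obtain ⟨r, hr, htan⟩ := (hso B hB0).2 (ε / (2 * (k + 1))) (by positivity)
    refine ⟨r, hr, fun x hx η hη hηρ hηr => ?_⟩
    have hsteps : ∀ j : ℕ, ‖(tangentSpaceAt M x).starProjection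
        (φ (φ^[j] (x + η)) - φ^[j] (x + η))‖ ≤ ε / (2 * (k + 1)) * ‖η‖ ^ 2 := by
      intro j
      have hj := (norm_iterate_sub_le_of_contractsToNearest hc0 hc1
        (fun z hz => (hball x hx z hz).1) (hstart x hx η hη hηρ) j).2.2
      have h1 : ‖φ^[j] (x + η) - (x + η)‖ ≤ B * ‖η‖ ^ 2 := by
        refine (hj.trans (mul_le_of_le_one_right ?_ ?_)).trans (hlen x hx η hη hηρ)
        · exact div_nonneg (mul_nonneg zero_le_two Metric.infDist_nonneg) hc'.le
        · linarith [pow_nonneg hc0 j]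
      have := htan x hx η hη (φ^[j] (x + η) - x) (by rwa [sub_sub]) hηr
      rwa [add_sub_cancel] at this
    have hhead := norm_starProjection_iterate_sub_le _ hsteps k
    have htail := (Submodule.norm_starProjection_apply_le (tangentSpaceAt M x) _).trans
      (hψB x hx η hη hηρ k)
    calc ‖tangentProj M x (ψ x η - (x + η))‖
        = ‖(tangentSpaceAt M x).starProjection (ψ x η - φ^[k] (x + η)) +
            (tangentSpaceAt M x).starProjection (φ^[k] (x + η) - (x + η))‖ := by
          rw [← map_add, sub_add_sub_cancel]; rfl
      _ ≤ B * c ^ k * ‖η‖ ^ 2 + k * (ε / (2 * (k + 1)) * ‖η‖ ^ 2) :=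
          (norm_add_le _ _).trans (add_le_add htail hhead)
      _ ≤ ε / 2 * ‖η‖ ^ 2 + ε / 2 * ‖η‖ ^ 2 := by
          refine add_le_add (by gcongr) ?_
          rw [← mul_assoc]
          gcongr
          rw [← mul_div_assoc, div_le_div_iff₀ (by positivity) two_pos]
          nlinarith
      _ = ε * ‖η‖ ^ 2 := by ring
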